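/- There are absolute constants $C,T\in\mathbb{N}$ such that for every $n$ there are $a,b\le Cn$ for which every graph state on $n$ qubits can be generated from the $a\times b$ cluster state by single-qubit Pauli measurements and local Clifford unitaries in at most $T$ time steps. In detail: For a finite simple graph $G=(V,E)$ let $|G\rangle=2^{-|V|/2}\sum_{x\in\{0,1\}^V}(-1)^{q(x)}|x\rangle$, $q(x)=\sum_{\{i,j\}\in E}x_ix_j$, be its graph state; the $a\times b$ cluster state is the graph state of the $a\times b$ square lattice (nearest neighbours, open boundary). A protocol with $d$ time steps acts on the qubits of the lattice as follows: in each step, simultaneously on every qubit, one either applies a single-qubit Clifford unitary (possibly the identity) or measures one of the Pauli observables $X,Y,Z$; the choices made in a step may depend on all outcomes of the preceding steps (the classical processing of outcomes is not counted as time). Then for every $n$ there are $a,b\le Cn$ such that for every simple graph $G$ with vertex set $\{1,\dots,n\}$ there are $n$ distinct qubits $o_1,\dots,o_n$ of the $a\times b$ lattice and a protocol with at most $T$ time steps which, started on the $a\times b$ cluster state, for every sequence of measurement outcomes of nonzero probability ends in a product state $|G\rangle_{o_1\dots o_n}\otimes|\chi\rangle$, where $|\chi\rangle$ is a state of the remaining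 qubits (depending on the outcomes), and vertex $i$ of $G$ corresponds to $o_i$. -/

import Mathlib

namespace OneWay

/-- A (not necessarily normalised) state vector of qubits labelled by `V`, given by its amplitudes
in the computational basis. -/
abbrev StateVec (V : Type*) := (V → Fin 2) → ℂ

/-- `q(x)`: the number of edges of `G` both of whose end points carry the bit `1`. -/
noncomputable def edgeCount {V : Type*} [Fintype V] (G : SimpleGraph V) (x : V → Fin 2) : ℕ :=
  {e : Sym2 V | e ∈ G.edgeSet ∧ ∀ v ∈ e, x v = 1}.ncard

/-- The graph state `|G⟩ = 2^(-|V|/2) ∑ₓ (-1)^q(x) |x⟩`. -/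
noncomputable def graphState {V : Type*} [Fintype V] (G : SimpleGraph V) : StateVec V :=
  fun x => ((1 / Real.sqrt 2 : ℝ) : ℂ) ^ Fintype.card V * (-1) ^ edgeCount G x

/-- The `a × b` two-dimensional square lattice (nearest neighbours, open boundary). -/
def lattice (a b : ℕ) : SimpleGraph (Fin a × Fin b) :=
  (SimpleGraph.pathGraph a).boxProd (SimpleGraph.pathGraph b)

/-- The cluster state of the `a × b` lattice. -/
noncomputable def clusterState (a b : ℕ) : StateVec (Fin a × Fin b) :=
  graphState (lattice a b)

/-- The three single-qubit Pauli observables. -/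
inductive Pauli where
  | X
  | Y
  | Z

/-- The matrix of a Pauli observable. -/
def Pauli.matrix : Pauli → Matrix (Fin 2) (Fin 2) ℂ
  | .X => !![0, 1; 1, 0]
  | .Y => !![0, -Complex.I; Complex.I, 0]
  | .Z => !![1, 0; 0, -1]

/-- A single-qubit Clifford unitary normalises the Pauli group. (The conjugate of `X`, `Y` or `Z`
is Hermitian and traceless, so it lies in the Pauli group iff it is `± X`, `± Y` or `± Z`.) -/
def IsClifford (u : Matrix (Fin 2) (Fin 2) ℂ) : Prop :=
  u ∈ Matrix.unitaryGroup (Fin 2) ℂ ∧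
    ∀ P : Pauli, ∃ Q : Pauli, u * P.matrix * u.conjTranspose = Q.matrix ∨
      u * P.matrix * u.conjTranspose = -Q.matrix

/-- What may be done to one qubit in one time step: a Clifford unitary (possibly the identity), or
a projective measurement of a Pauli observable. -/
inductive LocalOp where
  | unitary (u : Matrix (Fin 2) (Fin 2) ℂ) (hu : IsClifford u)
  | measure (P : Pauli)

/-- The Kraus operator of a one-qubit operation for the recorded outcome `s`. A measurement of `P`
has the outcomes `s = 0, 1`, with the spectral projections `(I + (-1)^s P) / 2`; a unitary yields no
information: it always records `0`. -/
noncomputable def LocalOp.kraus : LocalOp → Fin 2 → Matrix (Fin 2) (Fin 2) ℂ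
  | .unitary u _, s => if s = 0 then u else 0
  | .measure P, s => (1 / 2 : ℂ) • (1 + (-1 : ℂ) ^ (s : ℕ) • P.matrix)

/-- The tensor product `⨂ᵥ K v` of one-qubit operators, applied to a state vector. -/
noncomputable def applyLocal {V : Type*} [Fintype V] [DecidableEq V]
    (K : V → Matrix (Fin 2) (Fin 2) ℂ) (ψ : StateVec V) : StateVec V :=
  fun x => ∑ y : V → Fin 2, (∏ v, K v (x v) (y v)) * ψ y

/-- An adaptive protocol with `d` time steps. In each step one single-qubit operation acts on each
qubit, all of them simultaneously; the operations of the later steps may depend on all measurement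
outcomes recorded before. -/
inductive Protocol (V : Type*) : ℕ → Type _ where
  | done : Protocol V 0
  | step {d : ℕ} (op : V → LocalOp) (next : (V → Fin 2) → Protocol V d) : Protocol V (d + 1)

/-- The unnormalised state of the register after running the protocol from `ψ`, in the branch with
recorded outcomes `s` (time step, then qubit). Its squared norm, for normalised `ψ`, is the
probability of the branch. -/
noncomputable def Protocol.branch {V : Type*} [Fintype V] [DecidableEq V] :
    {d : ℕ} → Protocol V d → (Fin d → V → Fin 2) → StateVec V → StateVec V
  | 0, .done, _, ψ => ψ
  | _ + 1, .step op next, s, ψ =>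
      (next (s 0)).branch (fun i => s i.succ) (applyLocal (fun v => (op v).kraus (s 0 v)) ψ)

/-- The register is in the state `φ ⊗ χ`, where the qubits selected by `out` carry `φ` and all the
other qubits carry some state `χ` (global scalars are absorbed in `χ`). -/
def OutputIs {V W : Type*} (out : W ↪ V) (ψ : StateVec V) (φ : StateVec W) : Prop :=
  ∃ χ : ({v : V // v ∉ Set.range out} → Fin 2) → ℂ,
    ∀ x : V → Fin 2, ψ x = φ (fun w => x (out w)) * χ (fun v => x v)

/-- Run on `ψ`, the protocol leaves the qubits selected by `out` in the state `φ` (up to a global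
phase), with certainty: this holds for all measurement outcomes of nonzero probability. -/
def Protocol.Generates {V W : Type*} [Fintype V] [DecidableEq V] {d : ℕ} (p : Protocol V d)
    (out : W ↪ V) (ψ : StateVec V) (φ : StateVec W) : Prop :=
  ∀ s : Fin d → V → Fin 2, p.branch s ψ ≠ 0 → OutputIs out (p.branch s ψ) φ

end OneWay

/-! The lattice of side `2n - 1` is bipartite. Measuring one colour class `A` in the `X` basis
leaves the other class in a superposition over all bit strings satisfying the parity checks at the
sites of `A`, shifted by the outcomes. The homogeneous checks form the discrete wave equation mod 2
with zero boundary values on the lines `0` and `2n`. As in d'Alembert's formula, its solutions are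
sums of two diagonal waves, `profile (R + C) + profile (R - C)`, with an even, `4n`-periodic profile
given by `n` free bits `x i`. On the diagonal one finds the single bits `x i`, which serve as
outputs, and for each pair `j < i` some site carries `x i + x j`.

Measuring a remaining site in the `X` basis gives a sign that is a character of `x`, hence a product
of one-bit signs. Measuring the site of `x i + x j` in the `Y` basis gives a power of `-I`; since `a
⊕ b = a + b - 2ab`, this is a product of one-bit phases times `(-1) ^ (x i * x j)`, that is, the
edge `{i, j}`. The bases depend on `G` only, so one step performs all measurements, and a second
step corrects bit flips and local phases on the outputs.

`sum_bipartite` carries out the projection, `IsLocalPhase.bra_X` and `IsLocalPhase.bra_Y` compute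
the phases, `generates_of_kernel` assembles the protocol for a general bipartite graph, and
`extendZero_eq_wave` solves the wave equation. -/

namespace OneWay

/-! ### Signs of graph states and parity checks. -/

/-- The number of edges inside the support of `x`, counted along an orientation of `G`. -/
lemma neg_one_pow_edgeCount {V : Type*} [Fintype V] (G : SimpleGraph V)
    (r : V → V → Prop) [DecidableRel r] (h : ∀ a b, G.Adj a b ↔ r a b ∨ r b a)
    (hr : ∀ a b, r a b → ¬ r b a) (x : V → Fin 2) :
    (-1 : ℂ) ^ edgeCount G x
      = ∏ a, ∏ b, if r a b then (-1 : ℂ) ^ ((x a : ℕ) * (x b : ℕ)) else 1 := by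
  classical
  have h1 : edgeCount G x
      = (Finset.univ.filter fun p : V × V => r p.1 p.2 ∧ x p.1 = 1 ∧ x p.2 = 1).card := by
    rw [edgeCount, ← Set.ncard_coe_finset,
      ← Set.InjOn.ncard_image (f := fun p : V × V => s(p.1, p.2))]
    · congr 1
      ext e
      induction e using Sym2.ind with
      | _ a b =>
        simp only [Set.mem_ofPred_eq, SimpleGraph.mem_edgeSet, Sym2.mem_iff, Finset.coe_filter,
          Finset.mem_univ, true_and, Set.mem_image, Prod.exists, Sym2.eq_iff, h]
        constructor
        · rintro ⟨hab | hab, hx⟩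
          · exact ⟨a, b, ⟨hab, hx a (Or.inl rfl), hx b (Or.inr rfl)⟩, Or.inl ⟨rfl, rfl⟩⟩
          · exact ⟨b, a, ⟨hab, hx b (Or.inr rfl), hx a (Or.inl rfl)⟩, Or.inr ⟨rfl, rfl⟩⟩
        · rintro ⟨c, d, ⟨hcd, hc, hd⟩, ⟨rfl, rfl⟩ | ⟨rfl, rfl⟩⟩
          · exact ⟨Or.inl hcd, by rintro v (rfl | rfl) <;> assumption⟩
          · exact ⟨Or.inr hcd, by rintro v (rfl | rfl) <;> assumption⟩
    · rintro ⟨a, b⟩ hab ⟨c, d⟩ hcd heq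
      simp only [Finset.coe_filter, Finset.mem_univ, true_and, Set.mem_ofPred_eq] at hab hcd
      rcases Sym2.eq_iff.1 heq with ⟨h1, h2⟩ | ⟨h1, h2⟩
      · exact Prod.ext h1 h2
      · subst h1 h2
        exact absurd hcd.1 (hr _ _ hab.1)
  rw [h1, ← Fintype.prod_prod_type' (fun a b => if r a b then (-1 : ℂ) ^ ((x a : ℕ) * (x b : ℕ)) else 1),
    ← Finset.prod_const, Finset.prod_filter]
  refine Finset.prod_congr rfl fun p _ => ?_
  by_cases hp : r p.1 p.2
  · simp only [hp, true_and, if_true]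
    generalize x p.1 = u
    generalize x p.2 = v
    fin_cases u <;> fin_cases v <;> simp
  · simp [hp]

/-- Consecutive local operations compose vertex by vertex. -/
lemma applyLocal_applyLocal {V : Type*} [Fintype V] [DecidableEq V]
    (K K' : V → Matrix (Fin 2) (Fin 2) ℂ) (ψ : StateVec V) :
    applyLocal K' (applyLocal K ψ) = applyLocal (fun v => K' v * K v) ψ := by
  funext x
  simp only [applyLocal, Finset.mul_sum, Matrix.mul_apply]
  rw [Finset.sum_comm]
  refine Finset.sum_congr rfl fun z _ => ?_
  rw [Finset.prod_univ_sum, Fintype.piFinset_univ, Finset.sum_mul]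
  refine Finset.sum_congr rfl fun y _ => ?_
  rw [Finset.prod_mul_distrib, mul_assoc]

/-- The parity of `f` over the neighbourhood of `a`. -/
noncomputable def parity {V : Type*} [Fintype V] (H : SimpleGraph V) (f : V → Fin 2) (a : V) :
    Fin 2 :=
  open Classical in ∑ b, if H.Adj a b then f b else 0

section Parity

variable {V : Type*} [Fintype V] (H : SimpleGraph V)

lemma parity_add (f g : V → Fin 2) (a : V) :
    parity H (f + g) a = parity H f a + parity H g a := by
  classical
  simp only [parity, Pi.add_apply, ← Finset.sum_add_distrib]
  exact Finset.sum_congr rfl fun b _ => by split_ifs <;> simp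

lemma parity_congr {f g : V → Fin 2} {a : V} (h : ∀ b, H.Adj a b → f b = g b) :
    parity H f a = parity H g a := by
  classical
  exact Finset.sum_congr rfl fun b _ => by split_ifs with hb <;> simp [h b, *]

lemma prod_neighbors_neg_one_pow [DecidableRel H.Adj] (c : Fin 2) (f : V → Fin 2) (a : V) :
    (∏ b, if H.Adj a b then (-1 : ℂ) ^ ((c : ℕ) * (f b : ℕ)) else 1)
      = (-1) ^ ((c : ℕ) * (parity H f a : ℕ)) := by
  classical
  have key : ∀ u v : Fin 2, (-1 : ℂ) ^ ((c : ℕ) * ((u + v : Fin 2) : ℕ))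
      = (-1) ^ ((c : ℕ) * (u : ℕ)) * (-1) ^ ((c : ℕ) * (v : ℕ)) := by
    intro u v
    fin_cases c <;> fin_cases u <;> fin_cases v <;> simp
  have hs : ∀ t : Finset V, (∏ b ∈ t, if H.Adj a b then (-1 : ℂ) ^ ((c : ℕ) * (f b : ℕ)) else 1)
      = (-1) ^ ((c : ℕ) * ((∑ b ∈ t, if H.Adj a b then f b else 0 : Fin 2) : ℕ)) := by
    intro t
    induction t using Finset.induction_on with
    | empty => simp
    | insert b t hb ih =>
      rw [Finset.prod_insert hb, Finset.sum_insert hb, key, ih]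
      split_ifs <;> simp
  rw [hs, parity]
  congr!

/-- Summing out one side of a bipartite graph state against `±`-states leaves parity checks. -/
lemma sum_bipartite (A : V → Prop) [DecidablePred A] [DecidableEq V]
    (hA : ∀ a b, H.Adj a b → (A a ↔ ¬ A b))
    (L : V → Fin 2 → ℂ) (s : V → Fin 2) (κ : V → ℂ)
    (hL : ∀ a, A a → ∀ y, L a y = κ a * (-1) ^ ((y : ℕ) * (s a : ℕ))) :
    ∑ y : V → Fin 2, (∏ v, L v (y v)) * (-1) ^ edgeCount H y
      = ∑ z : {v // ¬ A v} → Fin 2,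
          (∏ a : {v // A v}, if parity H (fun v => if h : A v then 0 else z ⟨v, h⟩) a = s a
            then 2 * κ a else 0) * ∏ b : {v // ¬ A v}, L b (z b) := by
  classical
  rw [← (Equiv.piEquivPiSubtypeProd A (fun _ => Fin 2)).symm.sum_comp, Fintype.sum_prod_type,
    Finset.sum_comm]
  refine Finset.sum_congr rfl fun z _ => ?_
  set e : V → Fin 2 := fun v => if h : A v then 0 else z ⟨v, h⟩ with he
  have hterm : ∀ t : {v // A v} → Fin 2,
      (∏ v, L v ((Equiv.piEquivPiSubtypeProd A (fun _ => Fin 2)).symm (t, z) v)) *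
        (-1) ^ edgeCount H ((Equiv.piEquivPiSubtypeProd A (fun _ => Fin 2)).symm (t, z))
      = (∏ a : {v // A v}, L a (t a) * (-1) ^ ((t a : ℕ) * (parity H e a : ℕ))) *
          ∏ b : {v // ¬ A v}, L b (z b) := by
    intro t
    set y := (Equiv.piEquivPiSubtypeProd A (fun _ => Fin 2)).symm (t, z) with hy
    have hyA : ∀ a : {v // A v}, y a = t a := fun a => by simp [hy, a.2]
    have hyB : ∀ b : {v // ¬ A v}, y b = z b := fun b => by simp [hy, b.2]
    -- Orienting every edge from its end in `A` groups the signs by the sites of `A`, so the sum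
    -- over the bits on `A` factorises.
    rw [neg_one_pow_edgeCount H (fun a b => A a ∧ H.Adj a b)
      (fun a b => ⟨fun h => by
        by_cases ha : A a
        · exact Or.inl ⟨ha, h⟩
        · exact Or.inr ⟨by have := hA a b h; tauto, h.symm⟩,
        fun h => h.elim (fun h => h.2) (fun h => h.2.symm)⟩)
      (fun a b h h' => (hA a b h.2).1 h.1 h'.1),
      ← Fintype.prod_subtype_mul_prod_subtype A (fun v => L v (y v)),
      ← Fintype.prod_subtype_mul_prod_subtype A
        (fun a => ∏ b, if A a ∧ H.Adj a b then (-1 : ℂ) ^ ((y a : ℕ) * (y b : ℕ)) else 1)]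
    have h2 : (∏ a : {v // ¬ A v}, ∏ b, if A a ∧ H.Adj a b
        then (-1 : ℂ) ^ ((y a : ℕ) * (y b : ℕ)) else 1) = 1 :=
      Finset.prod_eq_one fun a _ => Finset.prod_eq_one fun b _ => by simp [a.2]
    rw [h2, mul_one, mul_right_comm, ← Finset.prod_mul_distrib]
    congr 1
    · refine Finset.prod_congr rfl fun a _ => ?_
      simp only [a.2, true_and, hyA]
      rw [prod_neighbors_neg_one_pow]
      congr 4
      refine parity_congr H fun b hb => ?_
      have hb' : ¬ A b := (hA _ _ hb).1 a.2
      rw [hyB ⟨b, hb'⟩, he]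
      simp [hb']
    · exact Finset.prod_congr rfl fun b _ => by rw [hyB]
  simp only [hterm]
  rw [← Finset.sum_mul]
  congr 1
  have := Finset.prod_univ_sum (fun _ : {v // A v} => (Finset.univ : Finset (Fin 2)))
    (fun a c => L a c * (-1) ^ ((c : ℕ) * (parity H e a : ℕ)))
  rw [Fintype.piFinset_univ] at this
  rw [← this]
  refine Finset.prod_congr rfl fun a _ => ?_
  -- Each factor is `κ a * (1 + (-1) ^ (u + w))`, which is `2 * κ a` or `0`.
  simp only [hL _ a.2]
  generalize parity H e a = u
  generalize s a = w
  rw [Fin.sum_univ_two]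
  fin_cases u <;> fin_cases w <;> simp <;> ring

end Parity

/-! ### One-qubit Clifford gates and Pauli measurements. -/

lemma Fin2.add_self (a : Fin 2) : a + a = 0 := by
  revert a; decide

/-- `X ^ t` followed by a diagonal phase gate. -/
noncomputable def phaseShift (t : Fin 2) (g : Fin 2 → ℂ) : Matrix (Fin 2) (Fin 2) ℂ :=
  Matrix.of fun x y => if y = x + t then g x else 0

lemma eq_of_pow_four_eq_one {z : ℂ} (h : z ^ 4 = 1) :
    z = 1 ∨ z = -1 ∨ z = Complex.I ∨ z = -Complex.I := by
  have h1 : (z - 1) * ((z + 1) * ((z - Complex.I) * (z + Complex.I))) = 0 := by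
    have := Complex.I_sq
    linear_combination h + (1 - z ^ 2) * this
  rcases mul_eq_zero.1 h1 with h | h
  · exact Or.inl (sub_eq_zero.1 h)
  rcases mul_eq_zero.1 h with h | h
  · exact Or.inr (Or.inl (eq_neg_of_add_eq_zero_left h))
  rcases mul_eq_zero.1 h with h | h
  · exact Or.inr (Or.inr (Or.inl (sub_eq_zero.1 h)))
  · exact Or.inr (Or.inr (Or.inr (eq_neg_of_add_eq_zero_left h)))

/-- Conjugation by a monomial matrix sends `Z` to `± Z`, while `X` and `Y` become antidiagonal with
entries determined up to sign by `q = g 0 * conj (g 1)`. As `q ^ 4 = 1`, these are again `± X` or `±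
Y`. -/
lemma isClifford_phaseShift (t : Fin 2) (g : Fin 2 → ℂ) (hg : ∀ a, g a ^ 4 = 1) :
    IsClifford (phaseShift t g) := by
  have hM : phaseShift t g = if t = 0 then !![g 0, 0; 0, g 1] else !![0, g 0; g 1, 0] := by
    ext i j
    fin_cases t <;> fin_cases i <;> fin_cases j <;> simp [phaseShift]
  have hu : ∀ a, g a * (starRingEnd ℂ) (g a) = 1 := fun a => by
    rcases eq_of_pow_four_eq_one (hg a) with h | h | h | h <;> simp [h]
  have hc : (starRingEnd ℂ) (g 0 * (starRingEnd ℂ) (g 1)) = g 1 * (starRingEnd ℂ) (g 0) := by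
    simp [mul_comm]
  have hq : (g 0 * (starRingEnd ℂ) (g 1)) ^ 4 = 1 := by
    rw [mul_pow, ← map_pow, hg, hg]; simp
  have e0 := hu 0
  have e1 := hu 1
  rw [hM]
  refine ⟨?_, fun P => ?_⟩
  · rw [Matrix.mem_unitaryGroup_iff]
    ext i j
    fin_cases t <;> fin_cases i <;> fin_cases j <;>
      simp [Matrix.mul_apply, Matrix.star_eq_conjTranspose, e0, e1]
  · have hX : ∀ t : Fin 2, (if t = 0 then !![g 0, 0; 0, g 1] else !![0, g 0; g 1, 0]) *
        Pauli.X.matrix * (if t = 0 then !![g 0, 0; 0, g 1] else !![0, g 0; g 1, 0]).conjTranspose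
        = !![0, g 0 * (starRingEnd ℂ) (g 1); g 1 * (starRingEnd ℂ) (g 0), 0] := by
      intro t
      ext i j
      fin_cases t <;> fin_cases i <;> fin_cases j <;> simp [Pauli.matrix, Matrix.mul_apply]
    have hY : ∀ t : Fin 2, (if t = 0 then !![g 0, 0; 0, g 1] else !![0, g 0; g 1, 0]) *
        Pauli.Y.matrix * (if t = 0 then !![g 0, 0; 0, g 1] else !![0, g 0; g 1, 0]).conjTranspose
        = (-1) ^ (t : ℕ) • !![0, -Complex.I * (g 0 * (starRingEnd ℂ) (g 1));
            Complex.I * (g 1 * (starRingEnd ℂ) (g 0)), 0] := by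
      intro t
      ext i j
      fin_cases t <;> fin_cases i <;> fin_cases j <;>
        simp [Pauli.matrix, Matrix.mul_apply] <;> ring
    have hZ : ∀ t : Fin 2, (if t = 0 then !![g 0, 0; 0, g 1] else !![0, g 0; g 1, 0]) *
        Pauli.Z.matrix * (if t = 0 then !![g 0, 0; 0, g 1] else !![0, g 0; g 1, 0]).conjTranspose
        = (-1) ^ (t : ℕ) • Pauli.Z.matrix := by
      intro t
      ext i j
      fin_cases t <;> fin_cases i <;> fin_cases j <;>
        simp [Pauli.matrix, Matrix.mul_apply, e0, e1]
    cases P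
    · rw [hX, ← hc]
      rcases eq_of_pow_four_eq_one hq with h | h | h | h <;> rw [h]
      · exact ⟨.X, Or.inl (by ext i j; fin_cases i <;> fin_cases j <;> simp [Pauli.matrix])⟩
      · exact ⟨.X, Or.inr (by ext i j; fin_cases i <;> fin_cases j <;> simp [Pauli.matrix])⟩
      · exact ⟨.Y, Or.inr (by ext i j; fin_cases i <;> fin_cases j <;> simp [Pauli.matrix])⟩
      · exact ⟨.Y, Or.inl (by ext i j; fin_cases i <;> fin_cases j <;> simp [Pauli.matrix])⟩
    · rw [hY, ← hc]
      have key : ∃ Q : Pauli, !![0, -Complex.I * (g 0 * (starRingEnd ℂ) (g 1));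
            Complex.I * (starRingEnd ℂ) (g 0 * (starRingEnd ℂ) (g 1)), 0] = Q.matrix ∨
          !![0, -Complex.I * (g 0 * (starRingEnd ℂ) (g 1));
            Complex.I * (starRingEnd ℂ) (g 0 * (starRingEnd ℂ) (g 1)), 0] = -Q.matrix := by
        rcases eq_of_pow_four_eq_one hq with h | h | h | h <;> rw [h]
        · exact ⟨.Y, Or.inl (by ext i j; fin_cases i <;> fin_cases j <;> simp [Pauli.matrix])⟩
        · exact ⟨.Y, Or.inr (by ext i j; fin_cases i <;> fin_cases j <;> simp [Pauli.matrix])⟩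
        · exact ⟨.X, Or.inl (by ext i j; fin_cases i <;> fin_cases j <;> simp [Pauli.matrix])⟩
        · exact ⟨.X, Or.inr (by ext i j; fin_cases i <;> fin_cases j <;> simp [Pauli.matrix])⟩
      obtain ⟨Q, hQ⟩ := key
      refine ⟨Q, ?_⟩
      fin_cases t
      · simpa using hQ
      · rcases hQ with hQ | hQ
        · right; rw [hQ]; simp
        · left; rw [hQ]; simp
    · rw [hZ]
      refine ⟨.Z, ?_⟩
      fin_cases t <;> simp

lemma isClifford_one : IsClifford 1 :=
  ⟨one_mem _, fun P => ⟨P, Or.inl (by simp)⟩⟩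

/-- Amplitudes of the outgoing eigenvector in a measurement of `X` or `Y` (the value at `Z` is not
used). -/
noncomputable def Pauli.ket : Pauli → Fin 2 → Fin 2 → ℂ
  | .Y, s, x => 1 / 2 * Complex.I ^ (x : ℕ) * (-1) ^ ((x : ℕ) * (s : ℕ))
  | _, s, x => 1 / 2 * (-1) ^ ((x : ℕ) * (s : ℕ))

/-- Amplitudes of the covector in a measurement of `X` or `Y` (the value at `Z` is not used). -/
noncomputable def Pauli.bra : Pauli → Fin 2 → Fin 2 → ℂ
  | .Y, s, x => (-Complex.I) ^ (x : ℕ) * (-1) ^ ((x : ℕ) * (s : ℕ))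
  | _, s, x => (-1) ^ ((x : ℕ) * (s : ℕ))

/-- The spectral projections have rank one, so a measured qubit splits off as an outgoing ket times
a scalar; the scalar carries all dependence on the input. -/
lemma kraus_measure {P : Pauli} (hP : P = .X ∨ P = .Y) (s x y : Fin 2) :
    (LocalOp.measure P).kraus s x y = P.ket s x * P.bra s y := by
  rcases hP with rfl | rfl <;> fin_cases s <;> fin_cases x <;> fin_cases y <;>
    simp [LocalOp.kraus, Pauli.ket, Pauli.bra, Pauli.matrix] <;> ring_nf <;> norm_num

/-! ### Phases that one-qubit gates can undo. -/

/-- A function of bits which, up to a constant, is a product of fourth roots of unity each depending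
on one bit only. -/
def IsLocalPhase {W : Type*} [Fintype W] (h : (W → Fin 2) → ℂ) : Prop :=
  ∃ (c : ℂ) (g : W → Fin 2 → ℂ), (∀ w a, g w a ^ 4 = 1) ∧ ∀ x, h x = c * ∏ w, g w (x w)

namespace IsLocalPhase

variable {W : Type*} [Fintype W]

lemma const (c : ℂ) : IsLocalPhase fun _ : W → Fin 2 => c :=
  ⟨c, fun _ _ => 1, by simp, by simp⟩

lemma mul {h k : (W → Fin 2) → ℂ} (hh : IsLocalPhase h) (hk : IsLocalPhase k) :
    IsLocalPhase fun x => h x * k x := by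
  obtain ⟨c, g, hg, hx⟩ := hh
  obtain ⟨d, e, he, hy⟩ := hk
  refine ⟨c * d, fun w a => g w a * e w a, fun w a => by rw [mul_pow, hg, he, one_mul], fun x => ?_⟩
  simp only [hx, hy, Finset.prod_mul_distrib]
  ring

lemma prod {ι : Type*} (t : Finset ι) {h : ι → (W → Fin 2) → ℂ}
    (hh : ∀ i ∈ t, IsLocalPhase (h i)) : IsLocalPhase fun x => ∏ i ∈ t, h i x := by
  classical
  induction t using Finset.induction_on with
  | empty => simpa using const (1 : ℂ)
  | insert i t hi ih =>
    simp only [Finset.prod_insert hi]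
    exact (hh i (Finset.mem_insert_self _ _)).mul
      (ih fun j hj => hh j (Finset.mem_insert_of_mem hj))

lemma coord [DecidableEq W] (w : W) (g : Fin 2 → ℂ) (hg : ∀ a, g a ^ 4 = 1) :
    IsLocalPhase fun x => g (x w) := by
  refine ⟨1, fun v a => if v = w then g a else 1, fun v a => ?_, fun x => ?_⟩
  · dsimp only
    split_ifs <;> simp [hg]
  · simp

lemma bra_X_add (s u v : Fin 2) : Pauli.X.bra s (u + v) = Pauli.X.bra s u * Pauli.X.bra s v := by
  fin_cases s <;> fin_cases u <;> fin_cases v <;> simp [Pauli.bra]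

/-- An `X` measurement of a parity of bits contributes only local signs. -/
lemma bra_X [DecidableEq W] (s t : Fin 2) (F : (W → Fin 2) → Fin 2)
    (hF : ∀ x y, F (x + y) = F x + F y) : IsLocalPhase fun x => Pauli.X.bra s (t + F x) := by
  have h0 : F 0 = 0 := by simpa using hF 0 0
  have hsum : ∀ (S : Finset W) (f : W → W → Fin 2),
      Pauli.X.bra s (F (∑ w ∈ S, f w)) = ∏ w ∈ S, Pauli.X.bra s (F (f w)) := by
    intro S f
    induction S using Finset.induction_on with
    | empty => simp [h0, Pauli.bra]
    | insert w S hw ih => rw [Finset.sum_insert hw, Finset.prod_insert hw, hF, bra_X_add, ih]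
  -- An additive `F` followed by a character is a character of the bit string, hence the product of
  -- its values on single bits.
  refine ⟨Pauli.X.bra s t, fun w a => Pauli.X.bra s (F (Pi.single w a)), fun w a => ?_, fun x => ?_⟩
  · simp only [Pauli.bra, ← pow_mul]
    rw [mul_comm, pow_mul]
    norm_num
  · simp only [bra_X_add]
    rw [← hsum, Finset.univ_sum_single]

/-- A `Y` measurement of the sum of two bits contributes, besides local phases, a controlled phase
between them. -/
lemma bra_Y [DecidableEq W] (s t : Fin 2) (i j : W) :
    IsLocalPhase fun x => Pauli.Y.bra s (t + (x i + x j)) * (-1) ^ ((x i : ℕ) * (x j : ℕ)) := by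
  have hg : ∀ a, (Pauli.Y.bra s (t + a) / Pauli.Y.bra s t) ^ 4 = 1 := by
    intro a
    have hI : (-Complex.I) ^ 4 = 1 := by rw [Even.neg_pow (by decide), Complex.I_pow_four]
    fin_cases s <;> fin_cases t <;> fin_cases a <;> simp [Pauli.bra, hI]
  -- The ratio at `a = 1` squares to `-1`, so at `a = b = 1` the product of the ratios supplies
  -- exactly the controlled sign. Dividing by the value at `t` absorbs the offset.
  have hprod : ∀ a b : Fin 2, Pauli.Y.bra s (t + (a + b)) * (-1) ^ ((a : ℕ) * (b : ℕ))
      = Pauli.Y.bra s t * ((Pauli.Y.bra s (t + a) / Pauli.Y.bra s t) *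
        (Pauli.Y.bra s (t + b) / Pauli.Y.bra s t)) := by
    intro a b
    fin_cases s <;> fin_cases t <;> fin_cases a <;> fin_cases b <;> simp [Pauli.bra]
  simp only [hprod]
  exact (const _).mul ((coord i _ hg).mul (coord j _ hg))

end IsLocalPhase

/-! ### The two-step protocol on a bipartite graph. -/

section Generation

lemma LocalOp.kraus_unitary_of_ne_zero {u : Matrix (Fin 2) (Fin 2) ℂ} {hu : IsClifford u}
    {s : Fin 2} (h : (LocalOp.unitary u hu).kraus s ≠ 0) : (LocalOp.unitary u hu).kraus s = u := by
  simp only [kraus] at h ⊢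
  split_ifs at h ⊢
  · rfl
  · exact absurd rfl h

variable {V W : Type*} [LinearOrder W]

open Classical in
/-- The basis in which a qubit is measured: `Y` at the sites belonging to the edges of `G`. -/
noncomputable def siteBasis (G : SimpleGraph W) (site : W → W → V) (v : V) : Pauli :=
  if ∃ p : W × W, (p.2 < p.1 ∧ G.Adj p.1 p.2) ∧ site p.1 p.2 = v then .Y else .X

lemma siteBasis_eq (G : SimpleGraph W) (site : W → W → V) (v : V) :
    siteBasis G site v = .X ∨ siteBasis G site v = .Y := by
  unfold siteBasis
  split_ifs <;> simp

variable [Fintype V] [DecidableEq V] [Fintype W]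

open Classical in
/-- The product of the amplitudes of all measured parities is `(-1) ^ q` up to local phases. -/
lemma isLocalPhase_prod_bra (G : SimpleGraph W) (A : V → Prop) (out : W ↪ V)
    (F : V → (W → Fin 2) → Fin 2) (hadd : ∀ v x y, F v (x + y) = F v x + F v y)
    (site : W → W → V)
    (hsiteA : ∀ i j, j < i → ¬ A (site i j))
    (hsite_out : ∀ i j, j < i → site i j ∉ Set.range out)
    (hsiteF : ∀ i j, j < i → ∀ x, F (site i j) x = x i + x j)
    (hinj : ∀ i j k l, j < i → l < k → site i j = site k l → i = k ∧ j = l)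
    (s f : V → Fin 2) :
    IsLocalPhase fun x : W → Fin 2 =>
      (∏ b : {v // ¬ A v}, if (b : V) ∈ Set.range out then (1 : ℂ)
        else (siteBasis G site b).bra (s b) (f b + F b x)) * (-1) ^ edgeCount G x := by
  -- The sign of each edge is assigned to the site of its pair. Distinct pairs have distinct sites,
  -- so each measured qubit is charged with at most one edge and can be treated separately.
  have hedge : ∀ x : W → Fin 2, (-1 : ℂ) ^ edgeCount G x = ∏ b : {v // ¬ A v}, ∏ p : W × W,
      if (p.2 < p.1 ∧ G.Adj p.1 p.2) ∧ site p.1 p.2 = b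
        then (-1 : ℂ) ^ ((x p.1 : ℕ) * (x p.2 : ℕ)) else 1 := by
    intro x
    rw [neg_one_pow_edgeCount G (fun i j => j < i ∧ G.Adj i j)
      (fun a b => ⟨fun h => by
        rcases lt_or_gt_of_ne h.ne with hab | hab
        · exact Or.inr ⟨hab, h.symm⟩
        · exact Or.inl ⟨hab, h⟩, fun h => h.elim (fun h => h.2) (fun h => h.2.symm)⟩)
      (fun a b h h' => lt_asymm h.1 h'.1),
      ← Fintype.prod_prod_type' (fun i j => if j < i ∧ G.Adj i j
        then (-1 : ℂ) ^ ((x i : ℕ) * (x j : ℕ)) else 1), Finset.prod_comm]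
    refine Finset.prod_congr rfl fun p _ => ?_
    by_cases hp : p.2 < p.1 ∧ G.Adj p.1 p.2
    · rw [Fintype.prod_eq_single (⟨site p.1 p.2, hsiteA _ _ hp.1⟩ : {v // ¬ A v})]
      · simp [hp]
      · intro b hb
        rw [if_neg]
        rintro ⟨-, h⟩
        exact hb (Subtype.ext h.symm)
    · simp [hp]
  simp only [hedge, ← Finset.prod_mul_distrib]
  refine IsLocalPhase.prod _ fun b _ => ?_
  by_cases hb : ∃ p : W × W, (p.2 < p.1 ∧ G.Adj p.1 p.2) ∧ site p.1 p.2 = b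
  · have hY : siteBasis G site b = .Y := if_pos hb
    obtain ⟨p, hp, hpb⟩ := hb
    have hout : (b : V) ∉ Set.range out := hpb ▸ hsite_out _ _ hp.1
    have hpb' : ∀ x : W → Fin 2, (∏ q : W × W,
        if (q.2 < q.1 ∧ G.Adj q.1 q.2) ∧ site q.1 q.2 = b
        then (-1 : ℂ) ^ ((x q.1 : ℕ) * (x q.2 : ℕ)) else 1)
          = (-1 : ℂ) ^ ((x p.1 : ℕ) * (x p.2 : ℕ)) := by
      intro x
      rw [Fintype.prod_eq_single p]
      · simp [hp, hpb]
      · intro q hq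
        rw [if_neg]
        rintro ⟨hq', hqb⟩
        obtain ⟨h1, h2⟩ := hinj _ _ _ _ hq'.1 hp.1 (hqb.trans hpb.symm)
        exact hq (Prod.ext h1 h2)
    simp only [hpb', hout, if_false, hY]
    simp only [← hpb, hsiteF _ _ hp.1]
    exact IsLocalPhase.bra_Y _ _ _ _
  · have hX : siteBasis G site b = .X := if_neg hb
    have h1 : ∀ x : W → Fin 2, (∏ q : W × W,
        if (q.2 < q.1 ∧ G.Adj q.1 q.2) ∧ site q.1 q.2 = b
        then (-1 : ℂ) ^ ((x q.1 : ℕ) * (x q.2 : ℕ)) else 1) = 1 := by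
      intro x
      exact Finset.prod_eq_one fun q _ => if_neg fun h => hb ⟨q, h⟩
    simp only [h1, mul_one, hX]
    by_cases hout : (b : V) ∈ Set.range out
    · simpa only [hout, if_true] using IsLocalPhase.const 1
    · simp only [hout, if_false]
      exact IsLocalPhase.bra_X _ _ _ (hadd b)

open Classical in
/-- Measuring one side of a bipartite graph in the `X` basis leaves the other side in a superposition
over the kernel of the parity checks. If this kernel is parametrised by the bits of the output
qubits, and for each pair of these there is a qubit carrying their sum, then every graph state on the
outputs can be generated in two steps. -/
theorem generates_of_kernel (H : SimpleGraph V) (G : SimpleGraph W) (A : V → Prop)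
    (hA : ∀ a b, H.Adj a b → (A a ↔ ¬ A b)) (out : W ↪ V) (hout : ∀ w, ¬ A (out w))
    (F : V → (W → Fin 2) → Fin 2) (hadd : ∀ v x y, F v (x + y) = F v x + F v y)
    (hker : ∀ f : V → Fin 2, (∀ a, A a → parity H f a = 0) →
      ∀ v, ¬ A v → f v = F v fun w => f (out w))
    (hF : ∀ x a, A a → parity H (fun v => F v x) a = 0)
    (hFout : ∀ w x, F (out w) x = x w)
    (site : W → W → V)
    (hsiteA : ∀ i j, j < i → ¬ A (site i j))
    (hsite_out : ∀ i j, j < i → site i j ∉ Set.range out)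
    (hsiteF : ∀ i j, j < i → ∀ x, F (site i j) x = x i + x j)
    (hinj : ∀ i j k l, j < i → l < k → site i j = site k l → i = k ∧ j = l) :
    ∃ p : Protocol V 2, p.Generates out (graphState H) (graphState G) := by
  set P : V → Pauli := siteBasis G site with hP
  choose c g hg hphase using fun s f : V → Fin 2 =>
    isLocalPhase_prod_bra G A out F hadd site hsiteA hsite_out hsiteF hinj s f
  have hphase' : ∀ s f x, (∏ b : {v // ¬ A v}, if (b : V) ∈ Set.range out then (1 : ℂ)
      else (P b).bra (s b) (f b + F b x))
        = c s f * (∏ w, g s f w (x w)) * (-1) ^ edgeCount G x := by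
    intro s f x
    rw [← hphase, mul_assoc, ← mul_pow]
    simp [hP]
  -- A particular solution of the checks with right-hand side `s`. The default `0` is harmless:
  -- inconsistent outcomes have probability zero, as `hsol` shows.
  let f₀ : (V → Fin 2) → V → Fin 2 := fun s =>
    if h : ∃ f : V → Fin 2, ∀ a, A a → parity H f a = s a then h.choose else 0
  have hf₀ : ∀ s, (∃ f : V → Fin 2, ∀ a, A a → parity H f a = s a) →
      ∀ a, A a → parity H (f₀ s) a = s a := by
    intro s h
    simp only [f₀, dif_pos h]
    exact h.choose_spec
  let corr : (V → Fin 2) → W → Matrix (Fin 2) (Fin 2) ℂ := fun s w =>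
    phaseShift (f₀ s (out w)) fun a => (g s (f₀ s) w a)⁻¹
  have hcorr : ∀ s w, IsClifford (corr s w) := fun s w =>
    isClifford_phaseShift _ _ fun a => by rw [inv_pow, hg, inv_one]
  let op₁ : V → LocalOp := fun v =>
    if v ∈ Set.range out then .unitary 1 isClifford_one else .measure (P v)
  let op₂ : (V → Fin 2) → V → LocalOp := fun s v =>
    if h : v ∈ Set.range out then .unitary (corr s h.choose) (hcorr _ _)
    else .unitary 1 isClifford_one
  refine ⟨.step op₁ fun s => .step (op₂ s) fun _ => .done, fun σ hσ => ?_⟩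
  set s := σ 0
  set s' := σ 1
  let M : V → Matrix (Fin 2) (Fin 2) ℂ := fun v => (op₂ s v).kraus (s' v) * (op₁ v).kraus (s v)
  have hbranch : (Protocol.step op₁ fun s => .step (op₂ s) fun _ => .done).branch σ (graphState H)
      = applyLocal M (graphState H) := by
    simp only [Protocol.branch]
    exact applyLocal_applyLocal _ _ _
  rw [hbranch] at hσ ⊢
  -- A zero operator at one qubit annihilates the whole branch; this excludes the spurious outcome
  -- `1` of a unitary.
  have hMne : ∀ v, M v ≠ 0 := by
    intro v hv
    refine hσ (funext fun x => Finset.sum_eq_zero fun y _ => ?_)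
    rw [Finset.prod_eq_zero (Finset.mem_univ v) (by rw [hv]; rfl), zero_mul]
  have hMout : ∀ w x y, M (out w) x y
      = if y = x + f₀ s (out w) then (g s (f₀ s) w x)⁻¹ else 0 := by
    intro w x y
    have h : out w ∈ Set.range out := ⟨w, rfl⟩
    have hw : h.choose = w := out.injective h.choose_spec
    have h1 : op₁ (out w) = .unitary 1 isClifford_one := if_pos h
    have h2 : op₂ s (out w) = .unitary (corr s w) (hcorr s w) := by
      simp only [op₂]
      rw [dif_pos h]
      simp only [hw]
    have hne := hMne (out w)
    simp only [M, h1, h2] at hne ⊢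
    rw [LocalOp.kraus_unitary_of_ne_zero (left_ne_zero_of_mul hne),
      LocalOp.kraus_unitary_of_ne_zero (right_ne_zero_of_mul hne), mul_one]
    rfl
  have hMmeas : ∀ v, v ∉ Set.range out → ∀ x y, M v x y = (P v).ket (s v) x * (P v).bra (s v) y := by
    intro v h x y
    have h1 : op₁ v = .measure (P v) := if_neg h
    have h2 : op₂ s v = .unitary 1 isClifford_one := dif_neg h
    have hne := hMne v
    rw [← kraus_measure (siteBasis_eq G site v)]
    simp only [M, h1, h2] at hne ⊢
    rw [LocalOp.kraus_unitary_of_ne_zero (left_ne_zero_of_mul hne), one_mul]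
  clear_value M
  have hAout : ∀ a, A a → a ∉ Set.range out := by
    rintro a ha ⟨w, rfl⟩
    exact hout w ha
  have hPA : ∀ a, A a → P a = .X := by
    intro a ha
    refine if_neg ?_
    rintro ⟨p, hp, rfl⟩
    exact hsiteA _ _ hp.1 ha
  have hsum : ∀ x, applyLocal M (graphState H) x
      = ((1 / Real.sqrt 2 : ℝ) : ℂ) ^ Fintype.card V * ∑ z : {v // ¬ A v} → Fin 2,
          (∏ a : {v // A v}, if parity H (fun v => if h : A v then 0 else z ⟨v, h⟩) a = s a
            then 2 * Pauli.X.ket (s a) (x a) else 0) * ∏ b : {v // ¬ A v}, M b (x b) (z b) := by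
    intro x
    rw [← sum_bipartite H A hA (fun v y => M v (x v) y) s (fun v => Pauli.X.ket (s v) (x v)),
      Finset.mul_sum, applyLocal]
    · exact Finset.sum_congr rfl fun y _ => by rw [graphState]; ring
    · intro a ha y
      simp only [hMmeas a (hAout a ha), hPA a ha]
      rfl
  have hsol : ∃ f : V → Fin 2, ∀ a, A a → parity H f a = s a := by
    by_contra hno
    refine hσ (funext fun x => ?_)
    rw [hsum, Finset.sum_eq_zero, mul_zero]; · rfl
    intro z _
    have : ∃ a, A a ∧ parity H (fun v => if h : A v then 0 else z ⟨v, h⟩) a ≠ s a := by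
      by_contra! h
      exact hno ⟨_, h⟩
    obtain ⟨a, ha, hne⟩ := this
    rw [Finset.prod_eq_zero (Finset.mem_univ ⟨a, ha⟩) (if_neg hne), zero_mul]
  have hs := hf₀ s hsol
  set f := f₀ s
  have hpar : ∀ x' : W → Fin 2, ∀ a, A a →
      parity H (fun v => if A v then 0 else f v + F v x') a = s a := by
    intro x' a ha
    rw [parity_congr H (g := f + fun v => F v x'), parity_add, hs a ha, hF _ _ ha, add_zero]
    intro b hb
    simp [(hA a b hb).1 ha]
  have hval : ∀ x, applyLocal M (graphState H) x
      = ((1 / Real.sqrt 2 : ℝ) : ℂ) ^ Fintype.card V *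
        ((∏ a : {v // A v}, 2 * Pauli.X.ket (s a) (x a)) *
          ∏ b : {v // ¬ A v}, M b (x b) (f b + F b fun w => x (out w))) := by
    intro x
    rw [hsum]
    congr 1
    -- Only one `z` survives: the checks put `e + f` in the kernel, the corrections fix its bits at
    -- the outputs, and by `hker` these determine it on the complement of `A`.
    refine (Fintype.sum_eq_single
      (fun b : {v // ¬ A v} => f b + F b fun w => x (out w)) ?_).trans ?_
    rotate_left
    · congr 1
      refine Finset.prod_congr rfl fun a _ => if_pos ?_
      simpa using hpar (fun w => x (out w)) a a.2
    · intro z hz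
      by_contra hne
      obtain ⟨h1, h2⟩ := mul_ne_zero_iff.1 hne
      rw [Finset.prod_ne_zero_iff] at h1 h2
      refine hz (funext fun b => ?_)
      set e : V → Fin 2 := fun v => if h : A v then 0 else z ⟨v, h⟩ with he
      have hpe : ∀ a, A a → parity H e a = s a := by
        intro a ha
        by_contra h
        exact h1 ⟨a, ha⟩ (Finset.mem_univ _) (if_neg h)
      have hze : ∀ w, e (out w) = x (out w) + f (out w) := by
        intro w
        have := h2 ⟨out w, hout w⟩ (Finset.mem_univ _)
        rw [hMout] at this
        have h3 : z ⟨out w, hout w⟩ = x (out w) + f (out w) := by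
          by_contra h
          exact this (if_neg h)
        rw [← h3, he]
        exact dif_neg (hout w)
      have hk := hker (e + f) (fun a ha => by
        rw [parity_add, hpe a ha, hs a ha, Fin2.add_self]) b b.2
      have heb : e b = z b := dif_neg b.2
      have hcoord : (fun w => (e + f) (out w)) = fun w => x (out w) := by
        funext w
        rw [Pi.add_apply, hze, add_assoc, Fin2.add_self, add_zero]
      rw [hcoord, Pi.add_apply, heb] at hk
      rw [← hk, add_comm, add_assoc, Fin2.add_self, add_zero]
  have hsplit : ∀ x : V → Fin 2, (∏ b : {v // ¬ A v}, M b (x b) (f b + F b fun w => x (out w)))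
      = (∏ b : {v // ¬ A v}, if (b : V) ∈ Set.range out then (1 : ℂ) else (P b).ket (s b) (x b)) *
        c s f * (-1) ^ edgeCount G fun w => x (out w) := by
    intro x
    have h1 : (∏ w, (g s f w (x (out w)))⁻¹) = ∏ b : {v // ¬ A v},
        if (b : V) ∈ Set.range out then M b (x b) (f b + F b fun w => x (out w)) else 1 := by
      refine Fintype.prod_of_injective (fun w => (⟨out w, hout w⟩ : {v // ¬ A v}))
        (fun i j h => out.injective (congrArg Subtype.val h)) _ _ ?_ ?_
      · intro b hb
        rw [if_neg]
        rintro ⟨w, hw⟩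
        exact hb ⟨w, Subtype.ext hw⟩
      · intro w
        simp only [Set.mem_range_self, if_true, hMout, hFout]
        rw [if_pos (add_comm _ _)]
    have h2 : (∏ b : {v // ¬ A v}, M b (x b) (f b + F b fun w => x (out w)))
        = (∏ b : {v // ¬ A v}, if (b : V) ∈ Set.range out then (1 : ℂ)
            else (P b).ket (s b) (x b)) *
          (∏ b : {v // ¬ A v}, if (b : V) ∈ Set.range out then (1 : ℂ)
            else (P b).bra (s b) (f b + F b fun w => x (out w))) *
          ∏ b : {v // ¬ A v}, if (b : V) ∈ Set.range out
            then M b (x b) (f b + F b fun w => x (out w)) else 1 := by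
      rw [← Finset.prod_mul_distrib, ← Finset.prod_mul_distrib]
      refine Finset.prod_congr rfl fun b _ => ?_
      by_cases hb : (b : V) ∈ Set.range out
      · simp only [hb, if_true, one_mul]
      · simp only [hb, if_false, mul_one, hMmeas b hb]
    have h3 : (∏ w, g s f w (x (out w))) * ∏ w, (g s f w (x (out w)))⁻¹ = 1 := by
      rw [← Finset.prod_mul_distrib]
      refine Finset.prod_eq_one fun w _ => mul_inv_cancel₀ fun h => ?_
      have := hg s f w (x (out w))
      rw [h] at this
      norm_num at this
    rw [h2, ← h1, hphase']
    linear_combination (∏ b : {v // ¬ A v}, if (b : V) ∈ Set.range out then (1 : ℂ)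
      else (P b).ket (s b) (x b)) * c s f * (-1) ^ edgeCount G (fun w => x (out w)) * h3
  -- The corrections cancel the local phases, so what is left besides the sign of `G` depends on the
  -- measured qubits only. The last division compensates the normalisation inside `graphState G`.
  refine ⟨fun z => ((1 / Real.sqrt 2 : ℝ) : ℂ) ^ Fintype.card V *
    ((∏ a : {v // A v}, 2 * Pauli.X.ket (s a) (z ⟨a, hAout a a.2⟩)) *
      ((∏ b : {v // ¬ A v}, if h : (b : V) ∈ Set.range out then (1 : ℂ)
        else (P b).ket (s b) (z ⟨b, h⟩)) * c s f)) /
      ((1 / Real.sqrt 2 : ℝ) : ℂ) ^ Fintype.card W, fun x => ?_⟩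
  have h2 : ((1 / Real.sqrt 2 : ℝ) : ℂ) ^ Fintype.card W ≠ 0 :=
    pow_ne_zero _ (Complex.ofReal_ne_zero.2 (by positivity))
  rw [hval, hsplit, graphState]
  simp only [dite_eq_ite]
  field_simp

end Generation

/-! ### The wave equation mod 2 on the square lattice. -/

section Lattice

variable {a b : ℕ}

/-- Extension of a function on the lattice by zero, with coordinates starting from `1`. -/
def extendZero (f : Fin a × Fin b → Fin 2) (R C : ℤ) : Fin 2 :=
  ∑ v : Fin a × Fin b, if (v.1 : ℤ) + 1 = R ∧ (v.2 : ℤ) + 1 = C then f v else 0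

lemma extendZero_apply (f : Fin a × Fin b → Fin 2) (v : Fin a × Fin b) {R C : ℤ}
    (hR : (v.1 : ℤ) + 1 = R) (hC : (v.2 : ℤ) + 1 = C) : extendZero f R C = f v := by
  rw [extendZero, Fintype.sum_eq_single v, if_pos ⟨hR, hC⟩]
  intro u hu
  refine if_neg fun h => hu (Prod.ext (Fin.ext ?_) (Fin.ext ?_)) <;> omega

lemma extendZero_eq_zero (f : Fin a × Fin b → Fin 2) {R C : ℤ}
    (h : R ≤ 0 ∨ a < R ∨ C ≤ 0 ∨ b < C) : extendZero f R C = 0 := by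
  refine Finset.sum_eq_zero fun v _ => if_neg ?_
  have := v.1.isLt
  have := v.2.isLt
  omega

lemma lattice_adj (u v : Fin a × Fin b) : (lattice a b).Adj u v ↔
    (((u.1 : ℕ) + 1 = v.1 ∨ (v.1 : ℕ) + 1 = u.1) ∧ (u.2 : ℕ) = v.2) ∨
    (((u.2 : ℕ) + 1 = v.2 ∨ (v.2 : ℕ) + 1 = u.2) ∧ (u.1 : ℕ) = v.1) := by
  simp [lattice, SimpleGraph.boxProd_adj, SimpleGraph.pathGraph_adj, Fin.ext_iff]

lemma parity_lattice (f : Fin a × Fin b → Fin 2) (u : Fin a × Fin b) {R C : ℤ}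
    (hR : (u.1 : ℤ) + 1 = R) (hC : (u.2 : ℤ) + 1 = C) :
    parity (lattice a b) f u = extendZero f (R - 1) C + extendZero f (R + 1) C
      + extendZero f R (C - 1) + extendZero f R (C + 1) := by
  classical
  simp only [parity, extendZero, ← Finset.sum_add_distrib, lattice_adj]
  refine Finset.sum_congr rfl fun v _ => ?_
  split_ifs <;> omega

/-- The even, `4n`-periodic wave profile whose value at `2i` is the bit of vertex `i` of `n`
(vertices counted from `1`), restricted to `|k| ≤ 4n`. -/
def profile {n : ℕ} (x : Fin n → Fin 2) (k : ℤ) : Fin 2 :=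
  if h : 1 ≤ min (k.natAbs / 2) (2 * n - k.natAbs / 2) then
    x ⟨min (k.natAbs / 2) (2 * n - k.natAbs / 2) - 1, by omega⟩ else 0

/-- The superposition of the two diagonal waves of the given profile. -/
def wave {n : ℕ} (x : Fin n → Fin 2) (R C : ℤ) : Fin 2 :=
  profile x (R + C) + profile x (R - C)

section Wave

variable {n : ℕ} (x : Fin n → Fin 2)

lemma profile_add (y : Fin n → Fin 2) (k : ℤ) :
    profile (x + y) k = profile x k + profile y k := by
  unfold profile
  split_ifs <;> simp

lemma profile_congr {k l : ℤ}
    (h : min (k.natAbs / 2) (2 * n - k.natAbs / 2) = min (l.natAbs / 2) (2 * n - l.natAbs / 2)) :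
    profile x k = profile x l := by
  simp only [profile, h]

lemma profile_two_mul (i : Fin n) : profile x (2 * (i + 1)) = x i := by
  have h : min ((2 * ((i : ℤ) + 1)).natAbs / 2) (2 * n - (2 * ((i : ℤ) + 1)).natAbs / 2) = i + 1 := by
    omega
  simp only [profile, h]
  simp

/-- The two waves cancel on the lines `0` because the profile is even, and on the lines `2n` because
it is also symmetric about `2n`. Even arguments make the halving in `profile` exact, which the
second symmetry needs. -/
lemma wave_eq_zero {R C : ℤ} (hR : 0 ≤ R) (hR' : R ≤ 2 * n) (hC : 0 ≤ C) (hC' : C ≤ 2 * n)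
    (h : R = 0 ∨ R = 2 * n ∨ C = 0 ∨ C = 2 * n) (hp : (R + C) % 2 = 0) : wave x R C = 0 := by
  rw [wave, profile_congr x (k := R + C) (l := R - C), Fin2.add_self]
  omega

/-- Among the four neighbours each of the arguments `R + C ± 1` and `R - C ± 1` occurs twice. -/
lemma wave_equation (R C : ℤ) :
    wave x (R - 1) C + wave x (R + 1) C + wave x R (C - 1) + wave x R (C + 1) = 0 := by
  simp only [wave, show R - 1 + C = R + C - 1 by ring, show R - 1 - C = R - C - 1 by ring,
    show R + 1 + C = R + C + 1 by ring, show R + 1 - C = R - C + 1 by ring,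
    show R + (C - 1) = R + C - 1 by ring, show R - (C - 1) = R - C + 1 by ring,
    show R + (C + 1) = R + C + 1 by ring, show R - (C + 1) = R - C - 1 by ring]
  generalize profile x (R + C - 1) = p
  generalize profile x (R + C + 1) = q
  generalize profile x (R - C - 1) = r
  generalize profile x (R - C + 1) = t
  revert p q r t
  decide

end Wave

variable {n : ℕ}

lemma extendZero_wave (x : Fin n → Fin 2) {R C : ℤ} (hR : 0 ≤ R) (hR' : R ≤ 2 * n) (hC : 0 ≤ C)
    (hC' : C ≤ 2 * n) (hp : (R + C) % 2 = 0) :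
    extendZero (fun v : Fin (2 * n - 1) × Fin (2 * n - 1) => wave x (v.1 + 1) (v.2 + 1)) R C
      = wave x R C := by
  by_cases h : R = 0 ∨ R = 2 * n ∨ C = 0 ∨ C = 2 * n
  · rw [wave_eq_zero x hR hR' hC hC' h hp, extendZero_eq_zero]
    omega
  · rw [extendZero_apply _ (⟨R.toNat - 1, by omega⟩, ⟨C.toNat - 1, by omega⟩) (R := R) (C := C)]
    · congr 1 <;> simp <;> omega
    · simp; omega
    · simp; omega

lemma parity_wave (x : Fin n → Fin 2) (u : Fin (2 * n - 1) × Fin (2 * n - 1))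
    (hu : ((u.1 : ℕ) + u.2) % 2 = 1) :
    parity (lattice (2 * n - 1) (2 * n - 1)) (fun v => wave x (v.1 + 1) (v.2 + 1)) u = 0 := by
  rw [parity_lattice _ u rfl rfl]
  have := u.1.isLt
  have := u.2.isLt
  rw [extendZero_wave, extendZero_wave, extendZero_wave, extendZero_wave, wave_equation] <;> omega

/-- The sum of the first `i` values at the odd places of the first row. -/
def rowSum (f : Fin (2 * n - 1) × Fin (2 * n - 1) → Fin 2) (i : ℕ) : Fin 2 :=
  ∑ k ∈ Finset.range i, extendZero f 1 (2 * k + 1)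

/-- Every solution of the parity checks is a wave. -/
lemma extendZero_eq_wave (f : Fin (2 * n - 1) × Fin (2 * n - 1) → Fin 2)
    (hf : ∀ u, ((u.1 : ℕ) + u.2) % 2 = 1 → parity (lattice (2 * n - 1) (2 * n - 1)) f u = 0)
    (R : ℕ) (hR : R + 1 ≤ 2 * n) : ∀ C : ℤ, 0 ≤ C → C ≤ 2 * n → (R + C) % 2 = 0 →
      extendZero f R C = wave (fun i : Fin n => rowSum f (i + 1)) R C := by
  -- A wave has value `profile (2k + 2) + profile (2k)` at place `2k + 1` of row `1`, so the profile
  -- must be the sequence of partial sums of that row.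
  set x : Fin n → Fin 2 := fun i => rowSum f (i + 1) with hx
  have hprof : ∀ k : ℕ, k ≤ n → profile x (2 * k) = rowSum f k := by
    intro k hk
    rcases Nat.eq_zero_or_pos k with rfl | hk'
    · simp [profile, rowSum]
    · have := profile_two_mul x ⟨k - 1, by omega⟩
      simp only [hx] at this
      rw [show k - 1 + 1 = k by omega] at this
      rw [← this]
      congr 1
      simp; omega
  induction R using Nat.strong_induction_on with
  | _ R ih =>
    intro C hC hC' hp
    by_cases hb : R = 0 ∨ C = 0 ∨ C = 2 * n
    · rw [extendZero_eq_zero, wave_eq_zero] <;> omega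
    rcases Nat.lt_or_ge R 2 with hR1 | hR2
    · obtain rfl : R = 1 := by omega
      obtain ⟨k, rfl⟩ : ∃ k : ℕ, C = 2 * k + 1 := ⟨(C / 2).toNat, by omega⟩
      have h1 : profile x ((1 : ℕ) + (2 * k + 1)) = rowSum f (k + 1) := by
        rw [← hprof (k + 1) (by omega)]
        congr 1
        push_cast
        ring
      have h2 : profile x ((1 : ℕ) - (2 * k + 1)) = rowSum f k := by
        rw [← hprof k (by omega)]
        apply profile_congr
        omega
      rw [wave, h1, h2, rowSum, rowSum, Finset.sum_range_succ, add_right_comm, Fin2.add_self,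
        zero_add, Nat.cast_one]
    -- The check at `(R + 1, C)` expresses row `R + 2` through the two rows before it, by the same
    -- recursion for `f` and for the wave.
    · obtain ⟨R, rfl⟩ : ∃ Q, R = Q + 2 := ⟨R - 2, by omega⟩
      have hchk := hf (⟨R, by omega⟩, ⟨C.toNat - 1, by omega⟩) (by simp; omega)
      rw [parity_lattice f _ (R := (R : ℤ) + 1) (C := C) (by simp) (by simp; omega)] at hchk
      have hw := wave_equation x ((R : ℤ) + 1) C
      have e1 := ih R (by omega) (by omega) C hC hC' (by omega)
      have e2 := ih (R + 1) (by omega) (by omega) (C - 1) (by omega) (by omega) (by omega)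
      have e3 := ih (R + 1) (by omega) (by omega) (C + 1) (by omega) (by omega) (by omega)
      rw [show (R : ℤ) + 1 - 1 = R by ring, show (R : ℤ) + 1 + 1 = ((R + 2 : ℕ) : ℤ) by push_cast; ring]
        at hchk hw
      push_cast at e1 e2 e3
      rw [e1, e2, e3] at hchk
      generalize extendZero f ((R + 2 : ℕ) : ℤ) C = p at hchk ⊢
      generalize wave x ((R + 2 : ℕ) : ℤ) C = q at hw ⊢
      generalize wave x (R : ℤ) C = r at hchk hw
      generalize wave x ((R : ℤ) + 1) (C - 1) = s at hchk hw
      generalize wave x ((R : ℤ) + 1) (C + 1) = t at hchk hw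
      revert p q r s t
      decide

end Lattice

/-! ### Choice of output and edge sites. -/

/-- Every graph state on `n` qubits is generated from the cluster state of the square lattice of side
`2n - 1` in two steps. -/
theorem exists_generates_lattice (n : ℕ) (G : SimpleGraph (Fin n)) :
    ∃ (p : Protocol (Fin (2 * n - 1) × Fin (2 * n - 1)) 2)
      (out : Fin n ↪ Fin (2 * n - 1) × Fin (2 * n - 1)),
      p.Generates out (clusterState (2 * n - 1) (2 * n - 1)) (graphState G) := by
  let out : Fin n ↪ Fin (2 * n - 1) × Fin (2 * n - 1) :=
    ⟨fun i => (⟨i, by omega⟩, ⟨i, by omega⟩), fun i j h => Fin.ext (by simpa using h)⟩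
  -- With coordinates from `1`, the site solves `R + C = 2(i + 1)`, `R - C = 2(j + 1)`; it lies in
  -- the lattice exactly because `j < i`. The default `out i` never matters.
  let site : Fin n → Fin n → Fin (2 * n - 1) × Fin (2 * n - 1) := fun i j =>
    if h : j < i then (⟨i + j + 1, by omega⟩, ⟨i - j - 1, by omega⟩) else out i
  have hsite : ∀ i j, j < i → ((site i j).1 : ℕ) = i + j + 1 ∧ ((site i j).2 : ℕ) = i - j - 1 := by
    intro i j h
    simp [site, h]
  have houtv : ∀ i, ((out i).1 : ℕ) = i ∧ ((out i).2 : ℕ) = i := fun i => ⟨rfl, rfl⟩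
  have hzero : ∀ x : Fin n → Fin 2, profile x 0 = 0 := fun x => by simp [profile]
  have hwout : ∀ (x : Fin n → Fin 2) (i : Fin n), wave x ((i : ℤ) + 1) ((i : ℤ) + 1) = x i := by
    intro x i
    rw [wave, sub_self, hzero, add_zero, ← two_mul, profile_two_mul]
  obtain ⟨p, hp⟩ := generates_of_kernel (lattice (2 * n - 1) (2 * n - 1)) G
    (fun v => ((v.1 : ℕ) + v.2) % 2 = 1) (fun u v h => by rw [lattice_adj] at h; omega)
    out (fun i => by have := houtv i; omega) (fun v x => wave x (v.1 + 1) (v.2 + 1))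
    (fun v x y => by simp only [wave, profile_add]; abel)
    (fun f hf v hv => by
      have key := extendZero_eq_wave f hf
      have h1 := v.1.isLt
      have h2 := v.2.isLt
      have e1 := key (v.1 + 1) (by omega) (v.2 + 1) (by omega) (by omega) (by omega)
      push_cast at e1
      rw [extendZero_apply f v rfl rfl] at e1
      rw [e1]
      congr 1
      funext i
      -- The profile was found from the first row; evaluating the wave on the diagonal identifies
      -- its bits with the values of `f` at the outputs.
      have e2 := key (i + 1) (by omega) (i + 1) (by omega) (by omega) (by omega)
      push_cast at e2
      rw [hwout, extendZero_apply f (out i) (R := (i : ℤ) + 1) (C := (i : ℤ) + 1) rfl rfl] at e2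
      exact e2.symm)
    (fun x u hu => parity_wave x u hu)
    (fun i x => hwout x i)
    site (fun i j h => by have := hsite i j h; omega)
    (fun i j h => by
      rintro ⟨k, hk⟩
      have h1 := hsite i j h
      rw [← hk] at h1
      have := houtv k
      omega)
    (fun i j h x => by
      obtain ⟨h1, h2⟩ := hsite i j h
      have e1 : (((site i j).1 : ℕ) : ℤ) + 1 + (((site i j).2 : ℕ) + 1) = 2 * (i + 1) := by omega
      have e2 : (((site i j).1 : ℕ) : ℤ) + 1 - (((site i j).2 : ℕ) + 1) = 2 * (j + 1) := by omega
      simp only [wave, e1, e2, profile_two_mul])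
    (fun i j k l h h' e => by
      have h1 := hsite i j h
      have h2 := hsite k l h'
      rw [e] at h1
      exact ⟨Fin.ext (by omega), Fin.ext (by omega)⟩)
  exact ⟨p, out, hp⟩

end OneWay

theorem mainTheorem1 :
    ∃ C T : ℕ, ∀ n : ℕ, ∃ a b : ℕ, a ≤ C * n ∧ b ≤ C * n ∧
      ∀ G : SimpleGraph (Fin n),
        ∃ d : ℕ, d ≤ T ∧ ∃ (p : OneWay.Protocol (Fin a × Fin b) d) (out : Fin n ↪ Fin a × Fin b),
          p.Generates out (OneWay.clusterState a b) (OneWay.graphState G) := by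
  refine ⟨2, 2, fun n => ⟨2 * n - 1, 2 * n - 1, by omega, by omega, fun G => ⟨2, le_rfl, ?_⟩⟩⟩
  exact OneWay.exists_generates_lattice n G
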